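/- Let $P_5=\mathbb F_2[x_1,\dots,x_5]$ with $\deg x_j=1$, a module over the mod-2 Steenrod algebra $\mathcal A$ in the usual way: $Sq^0$ is the identity, $Sq^1(x_j)=x_j^2$, $Sq^k(x_j)=0$ for $k>1$, and the Cartan formula holds. Let $\mathcal A^+$ be the augmentation ideal of $\mathcal A$, so that $\mathcal A^+P_5=\sum_{k>0}Sq^k(P_5)$. The weight vector of a monomial $x=x_1^{a_1}\cdots x_5^{a_5}$ is $\omega(x)=(\omega_1(x),\omega_2(x),\dots)$, where $\omega_i(x)=\sum_{j=1}^5\alpha_{i-1}(a_j)$ and $\alpha_i(a)$ is the coefficient of $2^i$ in the binary expansion of $a$. Weight vectors and exponent vectors are ordered by the left lexicographical order. For a sequence $\omega=(\omega_1,\omega_2,\dots)$ of non-negative integers with finitely many non-zero terms put $\deg\omega=\sum_{i\geqslant 1}2^{i-1}\omega_i$; let $P_5(\omega)$ (respectively $P_5^-(\omega)$) be the subspace of $P_5$ spanned by the monomials $y$ with $\deg y=\deg\omega$ and $\omega(y)\leqslant\omega$ (respectively $\omega(y)<\omega$), and let $$QP_5(\omega)=P_5(\omega)/\big((\mathcal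 A^+P_5\cap P_5(\omega))+P_5^-(\omega)\big).$$ For monomials $x,y$ of the same degree write $y<x$ if $\omega(y)<\omega(x)$, or $\omega(y)=\omega(x)$ and the exponent vector of $y$ is smaller than that of $x$. A monomial $x$ is inadmissible if there are monomials $y_1,\dots,y_m$ ($m\geqslant 0$) with $y_t<x$ for all $t$ and $x-\sum_{t=1}^m y_t\in\mathcal A^+P_5$; otherwise it is admissible. Then $QP_5(3,3,4)=0$, where $(3,3,4)$ stands for $(3,3,4,0,0,\dots)$. Equivalently, there is no admissible monomial of degree $25$ in $P_5$ with weight vector $(3,3,4)$. -/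

import Mathlib

namespace HitProblem

/-- The polynomial algebra `P_n = 𝔽₂[x_1, …, x_n]`; the generator `x_{j+1}` is `X j`, `j : Fin n`. -/
abbrev P (n : ℕ) : Type := MvPolynomial (Fin n) (ZMod 2)

/-- The total Steenrod square on `P_n`, graded by a formal variable `T`: the homomorphism of
algebras `P_n → P_n[T]` with `x_j ↦ x_j + x_j² T`. -/
noncomputable def totalSq (n : ℕ) : P n →ₐ[ZMod 2] Polynomial (P n) :=
  MvPolynomial.aeval fun j =>
    Polynomial.C (MvPolynomial.X j) + Polynomial.C (MvPolynomial.X j ^ 2) * Polynomial.X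

/-- The Steenrod square `Sq^k : P_n → P_n`, the coefficient of `T^k` in the total square. -/
noncomputable def Sq (n k : ℕ) : Module.End (ZMod 2) (P n) :=
  ((Polynomial.lcoeff (P n) k).restrictScalars (ZMod 2)).comp (totalSq n).toLinearMap

theorem Sq_apply (n k : ℕ) (f : P n) : Sq n k f = (totalSq n f).coeff k := rfl

/-- The values of the Steenrod squares on the generators. -/
theorem Sq_X (n k : ℕ) (j : Fin n) :
    Sq n k (MvPolynomial.X j) =
      if k = 0 then MvPolynomial.X j else if k = 1 then MvPolynomial.X j ^ 2 else 0 := by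
  rw [Sq_apply, totalSq, MvPolynomial.aeval_X, Polynomial.coeff_add, Polynomial.coeff_C,
    Polynomial.coeff_C_mul, Polynomial.coeff_X]
  rcases k with _ | _ | k <;> simp

theorem Sq_one (n k : ℕ) : Sq n k 1 = if k = 0 then 1 else 0 := by
  rw [Sq_apply, map_one, Polynomial.coeff_one]

/-- The Cartan formula. -/
theorem Sq_mul (n k : ℕ) (f g : P n) :
    Sq n k (f * g) = ∑ p ∈ Finset.HasAntidiagonal.antidiagonal k, Sq n p.1 f * Sq n p.2 g := by
  simp only [Sq_apply, map_mul, Polynomial.coeff_mul]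

/-- The operations on `P_n` given by elements of the augmentation ideal `𝒜⁺` of the Steenrod
algebra: the linear combinations of the compositions of one or more squares `Sq^k`, `k > 0`. -/
noncomputable def augmentationOps (n : ℕ) :
    NonUnitalSubalgebra (ZMod 2) (Module.End (ZMod 2) (P n)) :=
  NonUnitalAlgebra.adjoin (ZMod 2) {θ | ∃ k : ℕ, 0 < k ∧ θ = Sq n k}

/-- The subspace `𝒜⁺P_n` of hit polynomials. -/
noncomputable def hit (n : ℕ) : Submodule (ZMod 2) (P n) :=
  Submodule.span (ZMod 2) {g | ∃ θ ∈ augmentationOps n, ∃ f : P n, g = θ f}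

/-- A polynomial is hit iff it is a finite sum of polynomials `Sq^k f` with `k > 0`. -/
theorem hit_eq_span_Sq (n : ℕ) :
    hit n = Submodule.span (ZMod 2) {g | ∃ k : ℕ, 0 < k ∧ ∃ f : P n, g = Sq n k f} := by
  apply le_antisymm
  · refine Submodule.span_le.2 ?_
    rintro g ⟨θ, hθ, f, rfl⟩
    have key : ∀ θ ∈ augmentationOps n, ∀ f : P n, θ f ∈ Submodule.span (ZMod 2)
        {g | ∃ k : ℕ, 0 < k ∧ ∃ f : P n, g = Sq n k f} := by
      intro θ hθ
      refine NonUnitalAlgebra.adjoin_induction ?_ ?_ ?_ ?_ ?_ hθ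
      · rintro _ ⟨k, hk, rfl⟩ f
        exact Submodule.subset_span ⟨k, hk, f, rfl⟩
      · intro x y _ _ hx hy f
        exact Submodule.add_mem _ (hx f) (hy f)
      · intro f
        exact Submodule.zero_mem _
      · intro x y _ _ hx _ f
        exact hx (y f)
      · intro r x _ hx f
        exact Submodule.smul_mem _ r (hx f)
    exact key θ hθ f
  · refine Submodule.span_mono ?_
    rintro g ⟨k, hk, f, rfl⟩
    exact ⟨Sq n k, NonUnitalAlgebra.subset_adjoin _ ⟨k, hk, rfl⟩, f, rfl⟩

/-- The monomial `x_1^{a_1} ⋯ x_n^{a_n}` with exponent vector `a`. -/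
noncomputable def mono {n : ℕ} (a : Fin n →₀ ℕ) : P n := MvPolynomial.monomial a 1

/-- The weight vector `ω(x)` of the monomial with exponent vector `a`: its entry with index `i`
(indices start at `0`) is the sum over `j` of the `i`-th binary digits of `a_j`. -/
noncomputable def weight {n : ℕ} (a : Fin n →₀ ℕ) : ℕ →₀ ℕ :=
  Finsupp.onFinset (Finset.range (∑ j, a j)) (fun i => ∑ j, ((a j).testBit i).toNat) (by
    intro i hi
    obtain ⟨j, -, hj⟩ := Finset.exists_ne_zero_of_sum_ne_zero hi
    have hbit : (a j).testBit i = true := by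
      by_contra h
      simp [h] at hj
    have h1 : i < 2 ^ i := Nat.lt_two_pow_self
    have h2 : 2 ^ i ≤ a j := Nat.ge_two_pow_of_testBit hbit
    have h3 : a j ≤ ∑ j, a j := Finset.single_le_sum (fun _ _ => Nat.zero_le _) (Finset.mem_univ j)
    exact Finset.mem_range.2 (by omega))

/-- The degree `∑ 2^i ω_i` (indices from `0`) of a weight vector. -/
def weightDegree (ω : ℕ →₀ ℕ) : ℕ := ω.sum fun i w => 2 ^ i * w

/-- `P_n(ω)`: the span of the monomials `y` with `deg y = deg ω` and `ω(y) ≤ ω` in the left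
lexicographical order. -/
noncomputable def PLe (n : ℕ) (ω : ℕ →₀ ℕ) : Submodule (ZMod 2) (P n) :=
  Submodule.span (ZMod 2)
    {f | ∃ a : Fin n →₀ ℕ, a.degree = weightDegree ω ∧ toLex (weight a) ≤ toLex ω ∧ f = mono a}

/-- `P_n⁻(ω)`: the span of the monomials `y` with `deg y = deg ω` and `ω(y) < ω`. -/
noncomputable def PLt (n : ℕ) (ω : ℕ →₀ ℕ) : Submodule (ZMod 2) (P n) :=
  Submodule.span (ZMod 2)
    {f | ∃ a : Fin n →₀ ℕ, a.degree = weightDegree ω ∧ toLex (weight a) < toLex ω ∧ f = mono a}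

/-- `QP_n(ω) = P_n(ω) / ((𝒜⁺P_n ∩ P_n(ω)) + P_n⁻(ω))`. -/
abbrev QP (n : ℕ) (ω : ℕ →₀ ℕ) : Type :=
  PLe n ω ⧸ ((hit n ⊓ PLe n ω) ⊔ PLt n ω).submoduleOf (PLe n ω)

/-- The order on monomials of the same degree: first by weight vector, then by exponent vector,
both in the left lexicographical order. -/
def MonoLT {n : ℕ} (a b : Fin n →₀ ℕ) : Prop :=
  a.degree = b.degree ∧
    (toLex (weight a) < toLex (weight b) ∨ (weight a = weight b ∧ toLex a < toLex b))

/-- A monomial is inadmissible if it is congruent modulo `𝒜⁺P_n` to a (possibly empty) sum of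
smaller monomials. -/
def Inadmissible {n : ℕ} (a : Fin n →₀ ℕ) : Prop :=
  ∃ (m : ℕ) (b : Fin m → (Fin n →₀ ℕ)),
    (∀ t, MonoLT (b t) a) ∧ mono a - ∑ t, mono (b t) ∈ hit n

/-- A monomial is admissible if it is not inadmissible. -/
def Admissible {n : ℕ} (a : Fin n →₀ ℕ) : Prop := ¬ Inadmissible a

end HitProblem

namespace HitProblem

/-! ### Binary digits of exponents and weight vectors -/

open MvPolynomial Finset

/-! Work modulo hit polynomials and smaller weight. A monomial of weight (3,3,4) is x_I (x_J x_K²)²,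
recorded by the complements {p,q}, {r,s}, {k} of I, J, K (`coblock`). `Sq_two_relation` kills the
blocks with k ∈ {r,s} and makes the others depend only on {p,q} and the triple {r,s,k}. If {p,q}
meets the triple, one relation from `Sq_one_relation` kills the block. Otherwise p, q, r, s, k are
distinct, the triple is the complement of {p,q}, and the class is some [pq]. `Sq_one_relation` then
says that [px]+[py]+[pz] = 0 for distinct x, y, z ≠ p. Adding the relations for the three triples
containing q leaves 3[pq] = [pq] = 0. -/

/-- The squarefree monomial `∏_{i ∈ S} x_i`. -/
noncomputable def sqfree {n : ℕ} (S : Finset (Fin n)) : P n := ∏ i ∈ S, X i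

/-- The exponent vector of `sqfree S`. -/
noncomputable def indic {n : ℕ} (S : Finset (Fin n)) : Fin n →₀ ℕ :=
  ∑ i ∈ S, Finsupp.single i 1

theorem indic_apply {n : ℕ} (S : Finset (Fin n)) (j : Fin n) :
    indic S j = if j ∈ S then 1 else 0 := by
  simp [indic, Finsupp.finsetSum_apply, Finsupp.single_apply]

theorem sqfree_mul_mono_sq {n : ℕ} (S : Finset (Fin n)) (s : Fin n →₀ ℕ) :
    sqfree S * mono s ^ 2 = mono (indic S + 2 • s) := by
  have h : sqfree S = mono (indic S) := by
    rw [mono, indic, monomial_sum_one]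
    rfl
  rw [h, mono, mono, mono, monomial_pow, monomial_mul]
  simp

theorem weight_apply {n : ℕ} (a : Fin n →₀ ℕ) (i : ℕ) :
    weight a i = ∑ j, ((a j).testBit i).toNat := rfl

theorem weight_zero {n : ℕ} (S : Finset (Fin n)) (s : Fin n →₀ ℕ) :
    weight (indic S + 2 • s) 0 = S.card := by
  rw [weight_apply, ← Finset.filter_univ_mem S, Finset.card_filter, Finset.filter_univ_mem]
  refine Finset.sum_congr rfl fun j _ => ?_
  by_cases h : j ∈ S <;> simp [indic_apply, h]

theorem weight_succ {n : ℕ} (S : Finset (Fin n)) (s : Fin n →₀ ℕ) (i : ℕ) :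
    weight (indic S + 2 • s) (i + 1) = weight s i := by
  rw [weight_apply, weight_apply]
  refine Finset.sum_congr rfl fun j _ => ?_
  have : (indic S + 2 • s) j / 2 = s j := by
    rw [Finsupp.add_apply, indic_apply, Finsupp.smul_apply, smul_eq_mul]
    split_ifs <;> omega
  rw [Nat.testBit_add_one, this]

theorem degree_indic_add {n : ℕ} (S : Finset (Fin n)) (s : Fin n →₀ ℕ) :
    (indic S + 2 • s).degree = S.card + 2 * s.degree := by
  simp [indic, map_sum]

theorem exists_eq_indic_add {n : ℕ} (a : Fin n →₀ ℕ) :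
    ∃ (S : Finset (Fin n)) (s : Fin n →₀ ℕ), a = indic S + 2 • s := by
  refine ⟨univ.filter fun j => a j % 2 = 1, a.mapRange (· / 2) rfl, ?_⟩
  ext j
  by_cases h : a j % 2 = 1 <;> simp [indic_apply, h] <;> omega

theorem eq_zero_of_weight {n : ℕ} (a : Fin n →₀ ℕ) (h : weight a = 0) : a = 0 := by
  ext j
  refine Nat.eq_of_testBit_eq fun i => ?_
  have hi : weight a i = 0 := by rw [h]; rfl
  rw [weight_apply, Finset.sum_eq_zero_iff] at hi
  simpa using hi j (mem_univ j)

theorem weightDegree_toFinsupp_cons (w : ℕ) (l : List ℕ) :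
    weightDegree (w :: l).toFinsupp = w + 2 * weightDegree l.toFinsupp := by
  have key : ∀ l : List ℕ,
      weightDegree l.toFinsupp = ∑ i ∈ range l.length, 2 ^ i * l.getD i 0 := by
    intro l
    rw [weightDegree, Finsupp.sum_of_support_subset (s := range l.length)]
    · rfl
    · rw [List.toFinsupp_support]
      exact Finset.filter_subset _ _
    · simp
  rw [key, key, List.length_cons, Finset.sum_range_succ', Finset.mul_sum]
  simp only [List.getD_cons_succ, List.getD_cons_zero, pow_succ]
  rw [add_comm]
  congr 1
  · simp
  · exact Finset.sum_congr rfl fun i _ => by ring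

theorem weightDegree_toFinsupp_nil : weightDegree ([] : List ℕ).toFinsupp = 0 := by
  simp [weightDegree]

/-! ### Criteria for lying in smaller weight -/

theorem sqfree_mul_sq_mem {n : ℕ} (p : Submodule (ZMod 2) (P n)) (S : Finset (Fin n)) (g : P n)
    (h : ∀ s ∈ g.support, sqfree S * mono s ^ 2 ∈ p) : sqfree S * g ^ 2 ∈ p := by
  rw [g.as_sum, sum_pow_char, Finset.mul_sum]
  refine Submodule.sum_mem _ fun s hs => ?_
  have : monomial s (coeff s g) = coeff s g • (mono s : P n) := by
    rw [mono, smul_monomial, smul_eq_mul, mul_one]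
  rw [this, smul_pow, mul_smul_comm]
  exact p.smul_mem _ (h s hs)

/-- Every monomial of x_S g² has first weight entry |S|, which already decides the lexicographic
comparison; homogeneity only fixes the degree. -/
theorem sqfree_mul_sq_mem_PLt_of_card_lt {n w : ℕ} {l : List ℕ} {S : Finset (Fin n)} {g : P n}
    {d : ℕ} (hg : g.IsHomogeneous d) (hS : S.card < w)
    (hd : S.card + 2 * d = w + 2 * weightDegree l.toFinsupp) :
    sqfree S * g ^ 2 ∈ PLt n (w :: l).toFinsupp := by
  refine sqfree_mul_sq_mem _ S g fun s hs => Submodule.subset_span ⟨indic S + 2 • s, ?_, ?_,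
    sqfree_mul_mono_sq S s⟩
  · have : s.degree = d := by
      rw [Finsupp.degree_eq_weight_one]
      exact hg (mem_support_iff.1 hs)
    rw [degree_indic_add, weightDegree_toFinsupp_cons, ← hd, ← this]
  · refine Finsupp.lex_def.2 ⟨0, fun d hd => absurd hd (Nat.not_lt_zero d), ?_⟩
    simpa [weight_zero] using hS

/-- Passing from g to x_S g² is additive in characteristic 2 and prepends |S| to each weight vector,
so a strict drop at index i moves to i + 1. -/
theorem sqfree_mul_sq_mem_PLt_of_mem {n w : ℕ} {l : List ℕ} {S : Finset (Fin n)} {g : P n}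
    (hS : S.card = w) (hg : g ∈ PLt n l.toFinsupp) :
    sqfree S * g ^ 2 ∈ PLt n (w :: l).toFinsupp := by
  induction hg using Submodule.span_induction with
  | mem x hx =>
    obtain ⟨a, ha, ⟨i, hi, hlt⟩, rfl⟩ := hx
    refine Submodule.subset_span ⟨indic S + 2 • a, ?_, ⟨i + 1, ?_, ?_⟩, sqfree_mul_mono_sq S a⟩
    · rw [degree_indic_add, weightDegree_toFinsupp_cons, hS, ha]
    · rintro (_ | d) hd
      · simpa [weight_zero] using hS
      · have := hi d (by omega)
        simpa [weight_succ] using this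
    · simpa [weight_succ] using hlt
  | zero => simp
  | add x y _ _ hx hy => rw [add_pow_char, mul_add]; exact add_mem hx hy
  | smul r x _ hx => rw [smul_pow, mul_smul_comm]; exact Submodule.smul_mem _ _ hx

/-- A monomial of weight vector `(u, v, w)` is `x_I (x_J x_K²)²` with `|I| = u`, `|J| = v` and
`|K| = w`. -/
theorem mono_eq_of_weight {n u v w : ℕ} (a : Fin n →₀ ℕ)
    (h : weight a = ([u, v, w] : List ℕ).toFinsupp) :
    ∃ I J K : Finset (Fin n), I.card = u ∧ J.card = v ∧ K.card = w ∧
      mono a = sqfree I * (sqfree J * sqfree K ^ 2) ^ 2 := by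
  obtain ⟨I, b, rfl⟩ := exists_eq_indic_add a
  obtain ⟨J, c, rfl⟩ := exists_eq_indic_add b
  obtain ⟨K, d, rfl⟩ := exists_eq_indic_add c
  have hw := fun i => DFunLike.congr_fun h i
  have hd : d = 0 := by
    refine eq_zero_of_weight d (Finsupp.ext fun i => ?_)
    have := hw (i + 3)
    rw [weight_succ, weight_succ, weight_succ] at this
    simpa using this
  subst hd
  refine ⟨I, J, K, ?_, ?_, ?_, ?_⟩
  · have := hw 0
    rw [weight_zero] at this
    simpa using this
  · have := hw 1
    rw [weight_succ, weight_zero] at this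
    simpa using this
  · have := hw 2
    rw [weight_succ, weight_succ, weight_zero] at this
    simpa using this
  · rw [← sqfree_mul_mono_sq, ← sqfree_mul_mono_sq, ← sqfree_mul_mono_sq]
    simp [mono]

/-! ### Cartan formula computations for Sq^1 and Sq^2 -/

theorem Sq_zero {n : ℕ} (f : P n) : Sq n 0 f = f := by
  induction f using MvPolynomial.induction_on with
  | C a => simp [Sq_apply, totalSq, Polynomial.algebraMap_apply, MvPolynomial.algebraMap_eq]
  | add f g hf hg => rw [map_add, hf, hg]
  | mul_X f j hf => simp [Sq_mul, Sq_X, hf]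

theorem Sq_one_mul {n : ℕ} (f g : P n) : Sq n 1 (f * g) = Sq n 1 f * g + f * Sq n 1 g := by
  rw [Sq_mul, Finset.Nat.sum_antidiagonal_eq_sum_range_succ_mk]
  simp [Finset.sum_range_succ, Sq_zero, add_comm]

theorem Sq_two_mul {n : ℕ} (f g : P n) :
    Sq n 2 (f * g) = Sq n 2 f * g + Sq n 1 f * Sq n 1 g + f * Sq n 2 g := by
  rw [Sq_mul, Finset.Nat.sum_antidiagonal_eq_sum_range_succ_mk]
  simp only [Finset.sum_range_succ, Finset.sum_range_zero, Nat.sub_zero, Nat.sub_self,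
    Nat.add_one_sub_one, Sq_zero]
  ring

theorem Sq_one_sq {n : ℕ} (g : P n) : Sq n 1 (g ^ 2) = 0 := by
  rw [sq, Sq_one_mul, mul_comm g, CharTwo.add_self_eq_zero]

theorem Sq_two_sq {n : ℕ} (g : P n) : Sq n 2 (g ^ 2) = Sq n 1 g ^ 2 := by
  rw [sq, Sq_two_mul, mul_comm g, add_right_comm, CharTwo.add_self_eq_zero, zero_add, sq]

theorem Sq_mem_hit {n k : ℕ} (hk : 0 < k) (f : P n) : Sq n k f ∈ hit n := by
  rw [hit_eq_span_Sq]
  exact Submodule.subset_span ⟨k, hk, f, rfl⟩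

theorem Sq_one_sqfree {n : ℕ} (S : Finset (Fin n)) :
    Sq n 1 (sqfree S) = ∑ a ∈ S, sqfree (S.erase a) * X a ^ 2 := by
  induction S using Finset.induction_on with
  | empty => simp [sqfree, Sq_one]
  | insert b S hb ih =>
    have h : sqfree (insert b S) = X b * sqfree S := Finset.prod_insert hb
    rw [h, Sq_one_mul, ih, Finset.sum_insert hb, Finset.erase_insert hb, Finset.mul_sum, Sq_X,
      if_neg one_ne_zero, if_pos rfl, mul_comm]
    congr 1
    refine Finset.sum_congr rfl fun a ha => ?_
    have hab : b ≠ a := fun h => hb (h ▸ ha)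
    rw [Finset.erase_insert_of_ne hab, sqfree, sqfree, Finset.prod_insert, mul_assoc]
    exact fun h => hb (Finset.mem_of_mem_erase h)

theorem Sq_one_sqfree_mul_sq {n : ℕ} (S : Finset (Fin n)) (h : P n) :
    Sq n 1 (sqfree S * h ^ 2) = ∑ a ∈ S, sqfree (S.erase a) * (X a * h) ^ 2 := by
  rw [Sq_one_mul, Sq_one_sq, mul_zero, add_zero, Sq_one_sqfree, Finset.sum_mul]
  exact Finset.sum_congr rfl fun a _ => by ring

theorem Sq_two_mul_sq {n : ℕ} (f g : P n) :
    Sq n 2 (f * g ^ 2) = Sq n 2 f * g ^ 2 + f * Sq n 1 g ^ 2 := by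
  rw [Sq_two_mul, Sq_one_sq, Sq_two_sq, mul_zero, add_zero]

theorem X_mul_sqfree_of_notMem {n : ℕ} {S : Finset (Fin n)} {a : Fin n} (ha : a ∉ S) :
    X a * sqfree S = sqfree (insert a S) :=
  (Finset.prod_insert ha).symm

theorem X_mul_sqfree_of_mem {n : ℕ} {S : Finset (Fin n)} {a : Fin n} (ha : a ∈ S) :
    X a * sqfree S = sqfree (S.erase a) * X a ^ 2 := by
  rw [sqfree, ← Finset.mul_prod_erase S _ ha, sqfree]
  ring

theorem sqfree_isHomogeneous {n : ℕ} (S : Finset (Fin n)) :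
    (sqfree S).IsHomogeneous S.card := by
  rw [Finset.card_eq_sum_ones]
  exact IsHomogeneous.prod _ _ _ fun i _ => isHomogeneous_X _ i

/-! ### The two families of relations -/

/-- Each term of Sq^2(x_a x_b x_c) is one variable times the square of the other two, so the first
weight entry falls from 3 to 1. -/
theorem Sq_two_sqfree_mul_sq_mem_PLt {n : ℕ} {I : Finset (Fin n)} (hI : I.card = 3) {g : P n}
    (hg : g.IsHomogeneous 10) :
    Sq n 2 (sqfree I) * g ^ 2 ∈ PLt n ([3, 3, 4] : List ℕ).toFinsupp := by
  obtain ⟨a, b, c, hab, hac, hbc, rfl⟩ := Finset.card_eq_three.1 hI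
  have hdeg : weightDegree ([3, 4] : List ℕ).toFinsupp = 11 := by
    simp only [weightDegree_toFinsupp_cons, weightDegree_toFinsupp_nil, Nat.reduceMul,
      Nat.reduceAdd]
  have key : ∀ a b c : Fin n, sqfree {a} * (X b * X c * g) ^ 2 ∈
      PLt n ([3, 3, 4] : List ℕ).toFinsupp := fun a b c =>
    sqfree_mul_sq_mem_PLt_of_card_lt (((isHomogeneous_X _ b).mul (isHomogeneous_X _ c)).mul hg)
      (by simp) (by simp [hdeg])
  have h : sqfree {a, b, c} = (X a * X b * X c : P n) := by
    rw [sqfree, Finset.prod_insert (by simp [hab, hac]), Finset.prod_pair hbc, mul_assoc]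
  have h2 : Sq n 2 (sqfree {a, b, c}) * g ^ 2 = sqfree {a} * (X b * X c * g) ^ 2 +
      sqfree {b} * (X a * X c * g) ^ 2 + sqfree {c} * (X a * X b * g) ^ 2 := by
    rw [h]
    simp only [Sq_two_mul, Sq_one_mul, Sq_X, sqfree, Finset.prod_singleton]
    simp only [if_neg one_ne_zero, if_neg two_ne_zero, if_neg (show (2 : ℕ) ≠ 1 by decide), if_true]
    ring
  rw [h2]
  exact add_mem (add_mem (key _ _ _) (key _ _ _)) (key _ _ _)

/-- The relation given by `Sq^1 (x_A (x_B x_K²)²)`. -/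
theorem Sq_one_relation {n : ℕ} {A B K : Finset (Fin n)} (hA : A.card = 4) (hB : B.card = 2)
    (hK : K.card = 4) :
    ∑ a ∈ A \ B, sqfree (A.erase a) * (sqfree (insert a B) * sqfree K ^ 2) ^ 2 ∈
      hit n ⊔ PLt n ([3, 3, 4] : List ℕ).toFinsupp := by
  have h := Sq_mem_hit (k := 1) one_pos (sqfree A * (sqfree B * sqfree K ^ 2) ^ 2)
  rw [Sq_one_sqfree_mul_sq, ← Finset.sum_sdiff (Finset.inter_subset_left : A ∩ B ⊆ A),
    Finset.sdiff_inter_self_left] at h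
  have hdeg : weightDegree ([4] : List ℕ).toFinsupp = 4 := by
    simp only [weightDegree_toFinsupp_cons, weightDegree_toFinsupp_nil, Nat.reduceMul,
      Nat.reduceAdd]
  have hlow : ∑ a ∈ A ∩ B, sqfree (A.erase a) * (X a * (sqfree B * sqfree K ^ 2)) ^ 2 ∈
      PLt n ([3, 3, 4] : List ℕ).toFinsupp := by
    refine Submodule.sum_mem _ fun a ha => ?_
    obtain ⟨haA, haB⟩ := Finset.mem_inter.1 ha
    refine sqfree_mul_sq_mem_PLt_of_mem (by rw [Finset.card_erase_of_mem haA, hA]) ?_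
    -- As a ∈ B, x_a x_B = x_{B∖a} x_a²: the second weight entry is 1 instead of 3.
    rw [← mul_assoc, X_mul_sqfree_of_mem haB, mul_assoc, ← mul_pow]
    refine sqfree_mul_sq_mem_PLt_of_card_lt
      ((isHomogeneous_X _ a).mul (sqfree_isHomogeneous K)) ?_ ?_ <;>
    simp [Finset.card_erase_of_mem haB, hB, hK, hdeg]
  have hsum := Submodule.sub_mem _ (Submodule.mem_sup_left h) (Submodule.mem_sup_right hlow)
  rw [add_sub_cancel_right] at hsum
  convert hsum using 1
  refine Finset.sum_congr rfl fun a ha => ?_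
  rw [← mul_assoc, X_mul_sqfree_of_notMem (Finset.mem_sdiff.1 ha).2]

/-- The relation given by `Sq^2 (x_I (x_A x_L²)²)`. -/
theorem Sq_two_relation {n : ℕ} {I A L : Finset (Fin n)} (hI : I.card = 3) (hA : A.card = 4)
    (hL : L.card = 3) :
    ∑ a ∈ A \ L, sqfree I * (sqfree (A.erase a) * sqfree (insert a L) ^ 2) ^ 2 ∈
      hit n ⊔ PLt n ([3, 3, 4] : List ℕ).toFinsupp := by
  have h := Sq_mem_hit (k := 2) two_pos (sqfree I * (sqfree A * sqfree L ^ 2) ^ 2)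
  rw [Sq_two_mul_sq, Sq_one_sqfree_mul_sq,
    ← Finset.sum_sdiff (Finset.inter_subset_left : A ∩ L ⊆ A), Finset.sdiff_inter_self_left,
    add_pow_char, mul_add, add_left_comm] at h
  have hhom : (sqfree A * sqfree L ^ 2).IsHomogeneous 10 := by
    have := (sqfree_isHomogeneous A).mul ((sqfree_isHomogeneous L).pow 2)
    rwa [hA, hL] at this
  have hlow : sqfree I * (∑ a ∈ A ∩ L, sqfree (A.erase a) * (X a * sqfree L) ^ 2) ^ 2 ∈
      PLt n ([3, 3, 4] : List ℕ).toFinsupp := by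
    refine sqfree_mul_sq_mem_PLt_of_mem hI (Submodule.sum_mem _ fun a ha => ?_)
    obtain ⟨haA, haL⟩ := Finset.mem_inter.1 ha
    refine sqfree_mul_sq_mem_PLt_of_mem (by rw [Finset.card_erase_of_mem haA, hA]) ?_
    -- As a ∈ L, x_a x_L = x_{L∖a} x_a²: the third weight entry is 2 instead of 4.
    rw [X_mul_sqfree_of_mem haL]
    refine sqfree_mul_sq_mem_PLt_of_card_lt (isHomogeneous_X _ a) ?_ ?_ <;>
    simp [Finset.card_erase_of_mem haL, hL, weightDegree]
  have hsum := Submodule.sub_mem _ (Submodule.mem_sup_left h) (Submodule.mem_sup_right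
    (add_mem (Sq_two_sqfree_mul_sq_mem_PLt hI hhom) hlow))
  rw [add_sub_cancel_right, sum_pow_char, Finset.mul_sum] at hsum
  convert hsum using 1
  refine Finset.sum_congr rfl fun a ha => ?_
  rw [X_mul_sqfree_of_notMem (Finset.mem_sdiff.1 ha).2]

/-! ### Elimination of all blocks -/

/-- The monomial of weight vector `(3, 3, 4)` in which the binary digits of index `0`, `1`, `2`
vanish exactly at `{p, q}`, `{r, s}`, `{k}`. -/
noncomputable def coblock (p q r s k : Fin 5) : P 5 :=
  sqfree {p, q}ᶜ * (sqfree {r, s}ᶜ * sqfree {k}ᶜ ^ 2) ^ 2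

/-- The subspace `𝒜⁺P_5 + P_5⁻(3, 3, 4)`. -/
noncomputable def hitOrLow : Submodule (ZMod 2) (P 5) :=
  hit 5 ⊔ PLt 5 ([3, 3, 4] : List ℕ).toFinsupp

theorem coblock_comm_left (p q r s k : Fin 5) : coblock p q r s k = coblock q p r s k := by
  rw [coblock, Finset.pair_comm, coblock]

theorem coblock_comm_right (p q r s k : Fin 5) : coblock p q r s k = coblock p q s r k := by
  rw [coblock, Finset.pair_comm r s, coblock]

/-- The Sq^2 relation with A = {k}ᶜ ⊇ L = {r,k}ᶜ has a single term, since A ∖ L = {r}. -/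
theorem coblock_self_mem {p q r k : Fin 5} (hpq : p ≠ q) (hrk : r ≠ k) :
    coblock p q r k k ∈ hitOrLow := by
  have h := Sq_two_relation (I := {p, q}ᶜ) (A := {k}ᶜ) (L := {r, k}ᶜ)
    (by simp [Finset.card_compl, hpq]) (by simp [Finset.card_compl])
    (by simp [Finset.card_compl, hrk])
  have h1 : ({k}ᶜ \ {r, k}ᶜ : Finset (Fin 5)) = {r} := by ext; simp; grind
  have h2 : ({k}ᶜ : Finset (Fin 5)).erase r = {r, k}ᶜ := by ext; simp
  have h3 : insert r ({r, k}ᶜ : Finset (Fin 5)) = {k}ᶜ := by ext; simp; grind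
  rwa [h1, Finset.sum_singleton, h2, h3] at h

theorem coblock_add_coblock_swap_mem {p q r s k : Fin 5} (hpq : p ≠ q) (hrs : r ≠ s)
    (hrk : r ≠ k) (hsk : s ≠ k) : coblock p q r s k + coblock p q r k s ∈ hitOrLow := by
  have h := Sq_two_relation (I := {p, q}ᶜ) (A := {r}ᶜ) (L := {s, k}ᶜ)
    (by simp [Finset.card_compl, hpq]) (by simp [Finset.card_compl])
    (by simp [Finset.card_compl, hsk])
  have h1 : ({r}ᶜ \ {s, k}ᶜ : Finset (Fin 5)) = {s, k} := by ext; simp; grind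
  have h2 : ∀ x, ({r}ᶜ : Finset (Fin 5)).erase x = {r, x}ᶜ := by intro x; ext; simp; tauto
  have h3 : insert s ({s, k}ᶜ : Finset (Fin 5)) = {k}ᶜ := by ext; simp; grind
  have h4 : insert k ({s, k}ᶜ : Finset (Fin 5)) = {s}ᶜ := by ext; simp; grind
  rwa [h1, Finset.sum_pair hsk, h2, h2, h3, h4] at h

/-- The Sq^1 relation with A = {p}ᶜ and B = {x,y,z}ᶜ; an index equal to p is not in A, so its term
is absent. -/
theorem sum_coblock_mem (p : Fin 5) {x y z : Fin 5} (k : Fin 5) (hxy : x ≠ y) (hxz : x ≠ z)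
    (hyz : y ≠ z) :
    (if x = p then 0 else coblock p x y z k) + (if y = p then 0 else coblock p y x z k) +
      (if z = p then 0 else coblock p z x y k) ∈ hitOrLow := by
  have h := Sq_one_relation (A := {p}ᶜ) (B := {x, y, z}ᶜ) (K := {k}ᶜ)
    (by simp [Finset.card_compl]) (by simp [Finset.card_compl, hxy, hxz, hyz])
    (by simp [Finset.card_compl])
  have h1 : ({p}ᶜ \ {x, y, z}ᶜ : Finset (Fin 5)) =
      ({x, y, z} : Finset (Fin 5)).filter (¬ · = p) := by
    ext; simp; tauto
  have h2 : ∀ x, ({p}ᶜ : Finset (Fin 5)).erase x = {p, x}ᶜ := by intro x; ext; simp; tauto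
  have h3 : insert x ({x, y, z}ᶜ : Finset (Fin 5)) = {y, z}ᶜ := by ext; simp; grind
  have h4 : insert y ({x, y, z}ᶜ : Finset (Fin 5)) = {x, z}ᶜ := by ext; simp; grind
  have h5 : insert z ({x, y, z}ᶜ : Finset (Fin 5)) = {x, y}ᶜ := by ext; simp; grind
  rw [h1, Finset.sum_filter, Finset.sum_insert (by simp [hxy, hxz]), Finset.sum_pair hyz] at h
  simp only [h2, h3, h4, h5, ite_not] at h
  rwa [← add_assoc] at h

/-- In the Sq^1 relation for the triple {r,s,k}, the other two terms have k missing from both J and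
K, so `coblock_self_mem` removes them. -/
theorem coblock_mem_of_eq {p r s k : Fin 5} (hpk : p ≠ k) (hrs : r ≠ s) (hrk : r ≠ k)
    (hsk : s ≠ k) : coblock p k r s k ∈ hitOrLow := by
  have h := sum_coblock_mem p k hrs hrk hsk
  rw [if_neg hpk.symm] at h
  refine (Submodule.add_mem_iff_right _ (add_mem ?_ ?_)).1 h
  · split_ifs with h
    · exact zero_mem _
    · exact coblock_self_mem (Ne.symm h) hsk
  · split_ifs with h
    · exact zero_mem _
    · exact coblock_self_mem (Ne.symm h) hrk

/-- The Sq^2 swap moves q into the last position, which reduces to `coblock_mem_of_eq`. -/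
theorem coblock_mem_of_right_mem {p q r s k : Fin 5} (hpq : p ≠ q) (hrs : r ≠ s) (hrk : r ≠ k)
    (hsk : s ≠ k) (hq : q = r ∨ q = s ∨ q = k) : coblock p q r s k ∈ hitOrLow := by
  rcases hq with rfl | rfl | rfl
  · rw [coblock_comm_right]
    exact (Submodule.add_mem_iff_left _ (coblock_mem_of_eq hpq hsk hrs.symm hrk.symm)).1
      (coblock_add_coblock_swap_mem hpq hrs.symm hsk hrk)
  · exact (Submodule.add_mem_iff_left _ (coblock_mem_of_eq hpq hrk hrs hsk.symm)).1
      (coblock_add_coblock_swap_mem hpq hrs hrk hsk)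
  · exact coblock_mem_of_eq hpq hrs hrk hsk

theorem coblock_mem_of_disjoint {p a r s k : Fin 5} (hpa : p ≠ a) (hpr : p ≠ r) (hps : p ≠ s)
    (hpk : p ≠ k) (har : a ≠ r) (has : a ≠ s) (hak : a ≠ k) (hrs : r ≠ s) (hrk : r ≠ k)
    (hsk : s ≠ k) : coblock p a r s k ∈ hitOrLow := by
  have h1 := sum_coblock_mem p k har has hrs
  have h2 := sum_coblock_mem p s har hak hrk
  have h3 := sum_coblock_mem p r has hak hsk
  simp only [if_neg hpa.symm, if_neg hpr.symm, if_neg hps.symm, if_neg hpk.symm] at h1 h2 h3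
  have e1 := coblock_add_coblock_swap_mem hpa hrs hrk hsk
  have e2 := coblock_add_coblock_swap_mem hpa hrs.symm hsk hrk
  have e3 := coblock_add_coblock_swap_mem hpr has hak hsk
  have e4 := coblock_add_coblock_swap_mem hps har hak hrk
  have e5 := coblock_add_coblock_swap_mem hpk har has hrs
  rw [coblock_comm_right p a s r k] at e2
  have two : (2 : P 5) = 0 := CharTwo.two_eq_zero
  have key := add_mem (add_mem (add_mem h1 h2) h3)
    (add_mem (add_mem (add_mem e1 e2) (add_mem e3 e4)) e5)
  convert key using 1
  -- In `key` the target occurs three times and the eight other blocks twice each.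
  linear_combination -(coblock p a r s k + coblock p r a s k + coblock p s a r k +
    coblock p k a r s + coblock p a r k s + coblock p a s k r + coblock p r a k s +
    coblock p s a k r + coblock p k a s r) * two

theorem coblock_mem {p q r s k : Fin 5} (hpq : p ≠ q) (hrs : r ≠ s) :
    coblock p q r s k ∈ hitOrLow := by
  rcases eq_or_ne s k with rfl | hsk
  · exact coblock_self_mem hpq hrs
  rcases eq_or_ne r k with rfl | hrk
  · rw [coblock_comm_right]
    exact coblock_self_mem hpq hrs.symm
  by_cases hq : q = r ∨ q = s ∨ q = k
  · exact coblock_mem_of_right_mem hpq hrs hrk hsk hq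
  by_cases hp : p = r ∨ p = s ∨ p = k
  · rw [coblock_comm_left]
    exact coblock_mem_of_right_mem hpq.symm hrs hrk hsk hp
  push Not at hp hq
  exact coblock_mem_of_disjoint hpq hp.1 hp.2.1 hp.2.2 hq.1 hq.2.1 hq.2.2 hrs hrk hsk

theorem mono_mem_hitOrLow {a : Fin 5 →₀ ℕ} (ha : weight a = ([3, 3, 4] : List ℕ).toFinsupp) :
    mono a ∈ hitOrLow := by
  obtain ⟨I, J, K, hI, hJ, hK, h⟩ := mono_eq_of_weight a ha
  obtain ⟨p, q, hpq, hI'⟩ := Finset.card_eq_two.1 (show Iᶜ.card = 2 by simp [Finset.card_compl, hI])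
  obtain ⟨r, s, hrs, hJ'⟩ := Finset.card_eq_two.1 (show Jᶜ.card = 2 by simp [Finset.card_compl, hJ])
  obtain ⟨k, hK'⟩ := Finset.card_eq_one.1 (show Kᶜ.card = 1 by simp [Finset.card_compl, hK])
  rw [h, ← compl_compl I, ← compl_compl J, ← compl_compl K, hI', hJ', hK']
  exact coblock_mem hpq hrs

/-! ### Passage to the quotient and to admissibility -/

theorem exists_sum_mono_of_mem_PLt {n : ℕ} {ω : ℕ →₀ ℕ} {f : P n} (hf : f ∈ PLt n ω) :
    ∃ (m : ℕ) (b : Fin m → (Fin n →₀ ℕ)),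
      (∀ t, (b t).degree = weightDegree ω ∧ toLex (weight (b t)) < toLex ω) ∧
        f = ∑ t, mono (b t) := by
  induction hf using Submodule.span_induction with
  | mem x hx =>
    obtain ⟨a, ha, hlt, rfl⟩ := hx
    exact ⟨1, fun _ => a, fun _ => ⟨ha, hlt⟩, by simp⟩
  | zero => exact ⟨0, Fin.elim0, fun t => t.elim0, by simp⟩
  | add x y _ _ hx hy =>
    obtain ⟨m, b, hb, rfl⟩ := hx
    obtain ⟨m', b', hb', rfl⟩ := hy
    refine ⟨m + m', Fin.append b b', fun t => ?_, by simp [Fin.sum_univ_add]⟩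
    induction t using Fin.addCases with
    | left t => simpa using hb t
    | right t => simpa using hb' t
  | smul r x _ hx =>
    obtain ⟨m, b, hb, rfl⟩ := hx
    fin_cases r
    · exact ⟨0, Fin.elim0, fun t => t.elim0, (zero_smul (ZMod 2) _).trans (by simp)⟩
    · exact ⟨m, b, hb, one_smul _ _⟩

end HitProblem

open HitProblem in
theorem proposition4 :
    Subsingleton (HitProblem.QP 5 ([3, 3, 4] : List ℕ).toFinsupp) ∧
      ¬ ∃ a : Fin 5 →₀ ℕ, a.degree = 25 ∧
        HitProblem.weight a = ([3, 3, 4] : List ℕ).toFinsupp ∧ HitProblem.Admissible a := by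
  constructor
  · rw [Submodule.Quotient.subsingleton_iff, Submodule.submoduleOf_eq_top]
    refine Submodule.span_le.2 ?_
    rintro _ ⟨a, ha, hle, rfl⟩
    rcases hle.lt_or_eq with hlt | heq
    · exact Submodule.mem_sup_right (Submodule.subset_span ⟨a, ha, hlt, rfl⟩)
    · obtain ⟨h, hh, l, hl, hsum⟩ := Submodule.mem_sup.1 (mono_mem_hitOrLow (toLex_inj.1 heq))
      have hPLt : PLt 5 ([3, 3, 4] : List ℕ).toFinsupp ≤ PLe 5 ([3, 3, 4] : List ℕ).toFinsupp :=
        Submodule.span_mono fun _ ⟨b, hb, hlt, e⟩ => ⟨b, hb, hlt.le, e⟩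
      refine Submodule.mem_sup.2 ⟨h, ⟨hh, ?_⟩, l, hl, hsum⟩
      -- The hit part is the monomial minus its low part, hence lies in `PLe`.
      rw [← eq_sub_iff_add_eq] at hsum
      rw [hsum]
      exact Submodule.sub_mem _ (Submodule.subset_span ⟨a, ha, hle, rfl⟩) (hPLt hl)
  · rintro ⟨a, ha, hw, hadm⟩
    obtain ⟨h, hh, l, hl, hsum⟩ := Submodule.mem_sup.1 (mono_mem_hitOrLow hw)
    obtain ⟨m, b, hb, rfl⟩ := exists_sum_mono_of_mem_PLt hl
    have hdeg : weightDegree ([3, 3, 4] : List ℕ).toFinsupp = 25 := by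
      simp only [weightDegree_toFinsupp_cons, weightDegree_toFinsupp_nil, Nat.reduceMul,
      Nat.reduceAdd]
    -- The replacing monomials are smaller already by weight, so exponent vectors are never
    -- compared.
    refine hadm ⟨m, b, fun t => ⟨(hb t).1.trans (hdeg.trans ha.symm), Or.inl ?_⟩, ?_⟩
    · rw [hw]
      exact (hb t).2
    · rwa [← hsum, add_sub_cancel_right]
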